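/- Let $G$ be a nontrivial finite soluble group. Let $d(G)$ be the minimum number of generators of $G$, and for $x\in G$ let $d_{\{x\}}(G)$ be the smallest cardinality of a set of elements of $G$ that generates $G$ together with $x$. Write $x\equiv_{\mathrm m}y$ if $x$ and $y$ lie in exactly the same maximal subgroups of $G$, and, for a positive integer $r$, write $x\equiv_{\mathrm m}^{(r)}y$ if for all $z_1,\dots,z_{r-1}\in G$ one has $\langle x,z_1,\dots,z_{r-1}\rangle=G$ if and only if $\langle y,z_1,\dots,z_{r-1}\rangle=G$. Let $\psi(G)$ be the least positive integer $r$ for which $\equiv_{\mathrm m}^{(r)}$ coincides with $\equiv_{\mathrm m}$. Call $G$ efficiently generated if every $x\in G$ with $d_{\{x\}}(G)=d(G)$ lies in the Frattini subgroup $\mathrm{Frat}(G)$. Then $\psi(G)=d(G)$ if and only if $G$ is efficiently generated. -/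

import Mathlib

namespace GenEquiv

/-- `x ≡ₘ y`: the elements `x` and `y` lie in exactly the same maximal subgroups of `G`. -/
def MaxEquiv (G : Type*) [Group G] (x y : G) : Prop :=
  ∀ M : Subgroup G, IsCoatom M → (x ∈ M ↔ y ∈ M)

/-- `x ≡ₘ⁽ʳ⁾ y`, for a positive integer `r`: for all `z₁, …, z_{r-1}` in `G`, the elements
`x, z₁, …, z_{r-1}` generate `G` if and only if `y, z₁, …, z_{r-1}` generate `G`.
(Only used for `0 < r`.) -/
def SubstEquiv (G : Type*) [Group G] (r : ℕ) (x y : G) : Prop :=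
  ∀ z : Fin (r - 1) → G,
    Subgroup.closure (insert x (Set.range z)) = ⊤ ↔
      Subgroup.closure (insert y (Set.range z)) = ⊤

/-- `ψ(G)`: the least positive integer `r` such that `≡ₘ⁽ʳ⁾` coincides with `≡ₘ`. -/
noncomputable def psi (G : Type*) [Group G] : ℕ :=
  sInf {r : ℕ | 0 < r ∧ ∀ x y : G, SubstEquiv G r x y ↔ MaxEquiv G x y}

/-- `d_X(G)`: the smallest cardinality of a set of elements of `G` that generates `G` together
with the elements of `X`. -/
noncomputable def relRank (G : Type*) [Group G] (X : Set G) : ℕ :=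
  sInf {n : ℕ | ∃ S : Finset G, S.card = n ∧ Subgroup.closure (X ∪ (S : Set G)) = ⊤}

/-- `G` is efficiently generated: every `x` with `d_{x}(G) = d(G)` lies in the Frattini
subgroup. Here `d(G)` is `Group.rank G`. -/
def EfficientlyGenerated (G : Type*) [Group G] [Group.FG G] : Prop :=
  ∀ x : G, relRank G {x} = Group.rank G → x ∈ frattini G

/-- For a finite group, the infimum defining `ψ(G)` is that of a nonempty set. -/
theorem psi_set_nonempty (G : Type*) [Group G] [Finite G] :
    {r : ℕ | 0 < r ∧ ∀ x y : G, SubstEquiv G r x y ↔ MaxEquiv G x y}.Nonempty := by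
  classical
  have key : ∀ x y : G, SubstEquiv G (Nat.card G + 1) x y →
      ∀ M : Subgroup G, IsCoatom M → y ∈ M → x ∈ M := by
    intro x y h M hM hy
    by_contra hx
    let e : Fin (Nat.card G) ≃ G := (Finite.equivFin G).symm
    let z : Fin (Nat.card G + 1 - 1) → G := fun i => if e i ∈ M then e i else 1
    have hz : Set.range z ⊆ M := by
      rintro _ ⟨i, rfl⟩
      change (if e i ∈ M then e i else 1) ∈ M
      split_ifs with hi
      · exact hi
      · exact M.one_mem
    have hz' : ∀ g ∈ M, g ∈ Set.range z := by
      intro g hg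
      refine ⟨e.symm g, ?_⟩
      change (if e (e.symm g) ∈ M then e (e.symm g) else 1) = g
      simp [hg]
    have h1 : Subgroup.closure (insert x (Set.range z)) = ⊤ := by
      apply hM.2
      refine lt_of_le_of_ne
        (fun g hg => Subgroup.subset_closure (Set.mem_insert_of_mem _ (hz' g hg))) ?_
      intro heq
      exact hx (heq ▸ Subgroup.subset_closure (Set.mem_insert _ _))
    have h2 := (h z).1 h1
    apply hM.1
    rw [eq_top_iff, ← h2, Subgroup.closure_le]
    exact Set.insert_subset hy hz
  have key2 : ∀ (r : ℕ) (x y : G), MaxEquiv G x y → ∀ z : Fin (r - 1) → G,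
      Subgroup.closure (insert x (Set.range z)) = ⊤ →
        Subgroup.closure (insert y (Set.range z)) = ⊤ := by
    intro r x y h z hx
    by_contra hy
    obtain ⟨M, hM, hle⟩ := (eq_top_or_exists_le_coatom _).resolve_left hy
    rw [Subgroup.closure_le, Set.insert_subset_iff] at hle
    apply hM.1
    rw [eq_top_iff, ← hx, Subgroup.closure_le]
    exact Set.insert_subset ((h M hM).2 hle.1) hle.2
  refine ⟨Nat.card G + 1, Nat.succ_pos _, fun x y => ⟨fun h M hM => ⟨?_, ?_⟩, fun h z => ⟨?_, ?_⟩⟩⟩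
  · exact key y x (fun z => (h z).symm) M hM
  · exact key x y h M hM
  · exact key2 _ x y h z
  · exact key2 _ y x (fun M hM => (h M hM).symm) z

/-- For a finite group, the infimum defining `d_X(G)` is that of a nonempty set. -/
theorem relRank_set_nonempty (G : Type*) [Group G] [Finite G] (X : Set G) :
    {n : ℕ | ∃ S : Finset G, S.card = n ∧
      Subgroup.closure (X ∪ (S : Set G)) = ⊤}.Nonempty := by
  classical
  have := Fintype.ofFinite G
  exact ⟨_, Finset.univ, rfl, by simp⟩

end GenEquiv

/-! If `r - 1` elements complete neither `x` nor `y` to a generating set, then `x ≡ₘ⁽ʳ⁾ y`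
vacuously. For `r < d(G)` this relates all elements, so `ψ(G) ≥ d(G)`; for `r = d(G)` it relates
every `x` with `d_{x}(G) = d(G)` to `1`, so `ψ(G) = d(G)` forces such `x` into the Frattini
subgroup. Conversely, it suffices to complete any `x` outside a maximal subgroup `M` by `d(G) - 1`
elements of `M`. Solubility gives a normal `D` not in `M` with `D ⊓ M` normal. Completing some `a ∈
D \ M` and projecting to `M` along `D` gives a tuple in `M` that generates `G` with `x` modulo `D ⊓
M`. Gaschütz's lemma relative to `x` then corrects it by elements of `D ⊓ M`, so it stays in `M`. -/

namespace GenEquiv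

open Subgroup
open scoped commutatorElement

/-! ### Gaschütz's lemma relative to a fixed element -/

section Gaschutz

variable {G ι : Type*} [Group G]

/-- A supplement `L` of a normal subgroup `K` meets any two families of `ι`-indexed cosets of `K`
in sets that correspond under a left translation. -/
theorem exists_mul_mem_iff {K L : Subgroup G} [K.Normal] (hLK : L ⊔ K = ⊤) (g h : ι → G) :
    ∃ q : ι → K, ∀ (k : ι → K) (i : ι), g i * k i ∈ L ↔ h i * (q * k) i ∈ L := by
  have split : ∀ a : G, ∃ l ∈ L, ∃ c ∈ K, l * c = a := fun a =>
    Subgroup.mem_sup_of_normal_right.1 (hLK ▸ Subgroup.mem_top a)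
  choose l hl c hc hlc using split
  refine ⟨fun i => ⟨(c (h i))⁻¹ * c (g i), K.mul_mem (K.inv_mem (hc _)) (hc _)⟩, fun k i => ?_⟩
  have h1 : g i * k i = l (g i) * (c (g i) * k i) := by rw [← mul_assoc, hlc]
  have h2 : h i * ((c (h i))⁻¹ * c (g i) * k i) = l (h i) * (c (g i) * k i) := by
    nth_rewrite 1 [← hlc (h i)]
    group
  simp only [Pi.mul_apply, Subgroup.coe_mul]
  rw [h1, h2, L.mul_mem_cancel_left (hl _), L.mul_mem_cancel_left (hl _)]

/-- The subgroup generated by `x` and the translates `h i * k i`. -/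
def translateClosure (x : G) {K : Subgroup G} (h : ι → G) (k : ι → K) : Subgroup G :=
  closure (insert x (Set.range fun i => h i * (k i : G)))

theorem translateClosure_le_iff {x : G} {K : Subgroup G} {h : ι → G} {k : ι → K}
    {L : Subgroup G} : translateClosure x h k ≤ L ↔ x ∈ L ∧ ∀ i, h i * (k i : G) ∈ L := by
  simp [translateClosure, Subgroup.closure_le, Set.insert_subset_iff, Set.range_subset_iff]

theorem translateClosure_sup {x : G} {K : Subgroup G} {h : ι → G}
    (hh : closure (insert x (Set.range h)) ⊔ K = ⊤) (k : ι → K) :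
    translateClosure x h k ⊔ K = ⊤ := by
  rw [eq_top_iff, ← hh]
  refine sup_le ?_ le_sup_right
  have hle := translateClosure_le_iff.1 (le_sup_left : translateClosure x h k ≤ _ ⊔ K)
  rw [Subgroup.closure_le, Set.insert_subset_iff, Set.range_subset_iff]
  exact ⟨hle.1, fun i =>
    (Subgroup.mul_mem_cancel_right _ (Subgroup.mem_sup_right (k i).2)).1 (hle.2 i)⟩

variable [Finite G] [Finite ι]

/-- The number of translates by elements of `K` that generate a given subgroup together with `x`
does not depend on the family that is translated. -/
theorem card_translateClosure_eq {x : G} {K : Subgroup G} [K.Normal] {g h : ι → G}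
    (hg : closure (insert x (Set.range g)) ⊔ K = ⊤)
    (hh : closure (insert x (Set.range h)) ⊔ K = ⊤) (L : Subgroup G) :
    Nat.card {k : ι → K // translateClosure x g k = L} =
      Nat.card {k : ι → K // translateClosure x h k = L} := by
  classical
  have := Fintype.ofFinite (ι → K)
  have := Fintype.ofFinite (Subgroup G)
  -- Translates generating a subgroup of `L` are counted; removing those that generate a proper
  -- subgroup of `L` leaves the wanted number.
  induction L using WellFoundedLT.induction with
  | ind L ih =>
  by_cases hLK : L ⊔ K = ⊤
  swap
  · have hempty : ∀ f : ι → G, closure (insert x (Set.range f)) ⊔ K = ⊤ →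
        IsEmpty {k : ι → K // translateClosure x f k = L} := fun f hf =>
      ⟨fun k => hLK (k.2 ▸ translateClosure_sup hf k.1)⟩
    have := hempty g hg
    have := hempty h hh
    simp
  have count : ∀ f : ι → G, Nat.card {k : ι → K // translateClosure x f k ≤ L} =
      Nat.card {k : ι → K // translateClosure x f k = L} +
        ∑ L' ∈ Finset.univ.filter (· < L), Nat.card {k : ι → K // translateClosure x f k = L'} := by
    intro f
    simp only [Nat.card_eq_fintype_card, Fintype.card_subtype]
    rw [Finset.card_eq_sum_card_fiberwise (f := fun k => translateClosure x f k)
      (t := insert L (Finset.univ.filter (· < L)))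
      (fun k hk => by simpa [le_iff_eq_or_lt] using hk), Finset.sum_insert (by simp)]
    congr 1
    · congr 1
      ext k
      simpa using le_of_eq
    · refine Finset.sum_congr rfl fun L' hL' => ?_
      congr 1
      ext k
      simp only [Finset.mem_filter, Finset.mem_univ, true_and] at hL' ⊢
      exact ⟨And.right, fun hk => ⟨hk ▸ hL'.le, hk⟩⟩
  have total : Nat.card {k : ι → K // translateClosure x g k ≤ L} =
      Nat.card {k : ι → K // translateClosure x h k ≤ L} := by
    obtain ⟨q, hq⟩ := exists_mul_mem_iff hLK g h
    refine Nat.card_congr ((Equiv.mulLeft q).subtypeEquiv fun k => ?_)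
    rw [translateClosure_le_iff, translateClosure_le_iff]
    exact and_congr_right fun _ => forall_congr' fun i => hq k i
  rw [count, count, Finset.sum_congr rfl fun L' hL' => ih L' (Finset.mem_filter.1 hL').2] at total
  exact Nat.add_right_cancel total

/-- Gaschütz's lemma relative to a fixed element `x`. -/
theorem exists_translate_generates {x : G} {K : Subgroup G} [K.Normal] {g h : ι → G}
    (hg : closure (insert x (Set.range g)) = ⊤)
    (hh : closure (insert x (Set.range h)) ⊔ K = ⊤) :
    ∃ k : ι → K, closure (insert x (Set.range fun i => h i * (k i : G))) = ⊤ := by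
  have hcard := card_translateClosure_eq (by rw [hg, top_sup_eq]) hh ⊤
  have : Nonempty {k : ι → K // translateClosure x g k = ⊤} :=
    ⟨1, by simpa [translateClosure] using hg⟩
  have hpos := hcard ▸ Nat.card_pos
  exact nonempty_subtype.1 (Nat.card_pos_iff.1 hpos).1

end Gaschutz

/-! ### Relative rank and the lower bound for `ψ` -/

variable {G : Type*} [Group G]

theorem MaxEquiv.symm {x y : G} (h : MaxEquiv G x y) : MaxEquiv G y x :=
  fun M hM => (h M hM).symm

theorem SubstEquiv.symm {r : ℕ} {x y : G} (h : SubstEquiv G r x y) : SubstEquiv G r y x :=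
  fun z => (h z).symm

theorem closure_insert_range_eq_top_of_maxEquiv [Finite G] {n : ℕ} {x y : G}
    (h : MaxEquiv G x y) {z : Fin n → G} (hx : closure (insert x (Set.range z)) = ⊤) :
    closure (insert y (Set.range z)) = ⊤ := by
  by_contra hy
  obtain ⟨M, hM, hle⟩ := (eq_top_or_exists_le_coatom _).resolve_left hy
  rw [Subgroup.closure_le, Set.insert_subset_iff] at hle
  apply hM.1
  rw [eq_top_iff, ← hx, Subgroup.closure_le]
  exact Set.insert_subset ((h M hM).2 hle.1) hle.2

theorem MaxEquiv.substEquiv [Finite G] {x y : G} (h : MaxEquiv G x y) (r : ℕ) :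
    SubstEquiv G r x y := fun _ =>
  ⟨closure_insert_range_eq_top_of_maxEquiv h, closure_insert_range_eq_top_of_maxEquiv h.symm⟩

theorem mem_frattini_iff_maxEquiv_one {x : G} : x ∈ frattini G ↔ MaxEquiv G x 1 := by
  simp only [frattini, Order.radical, Subgroup.mem_iInf, MaxEquiv, Subgroup.one_mem, iff_true,
    Set.mem_ofPred_eq]

theorem exists_subset_range_of_card_le (S : Finset G) {n : ℕ} (h : S.card ≤ n) :
    ∃ z : Fin n → G, (S : Set G) ⊆ Set.range z := by
  refine ⟨fun i => if hi : i.1 < S.card then S.equivFin.symm ⟨i.1, hi⟩ else 1, fun s hs => ?_⟩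
  refine ⟨Fin.castLE h (S.equivFin ⟨s, hs⟩), ?_⟩
  simp

/-- `x` and `n` further elements generate `G` if and only if `d_{x}(G) ≤ n`. -/
theorem relRank_singleton_le_iff [Finite G] {x : G} {n : ℕ} :
    relRank G {x} ≤ n ↔ ∃ z : Fin n → G, closure (insert x (Set.range z)) = ⊤ := by
  classical
  constructor
  · intro h
    obtain ⟨S, hS, hgen⟩ := Nat.sInf_mem (relRank_set_nonempty G {x})
    obtain ⟨z, hz⟩ := exists_subset_range_of_card_le S (hS.trans_le h)
    refine ⟨z, eq_top_iff.2 (hgen.ge.trans (Subgroup.closure_mono ?_))⟩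
    rw [Set.singleton_union]
    exact Set.insert_subset_insert hz
  · rintro ⟨z, hz⟩
    have hmem : relRank G {x} ≤ (Finset.univ.image z).card :=
      Nat.sInf_le ⟨_, rfl, by simpa using hz⟩
    exact hmem.trans (Finset.card_image_le.trans (by simp))

theorem rank_le_relRank_singleton_add_one [Finite G] (x : G) :
    Group.rank G ≤ relRank G {x} + 1 := by
  classical
  obtain ⟨S, hS, hgen⟩ := Nat.sInf_mem (relRank_set_nonempty G {x})
  refine (Group.rank_le (S := insert x S) (by simpa using hgen)).trans ?_
  exact (Finset.card_insert_le _ _).trans (Nat.add_le_add_right hS.le 1)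

theorem relRank_singleton_le_rank [Finite G] (x : G) : relRank G {x} ≤ Group.rank G := by
  obtain ⟨S, hS, hgen⟩ := Group.rank_spec G
  exact Nat.sInf_le ⟨S, hS, eq_top_iff.2 (hgen.ge.trans (Subgroup.closure_mono
    Set.subset_union_right))⟩

theorem rank_le_relRank_one [Finite G] : Group.rank G ≤ relRank G {1} := by
  obtain ⟨S, hS, hgen⟩ := Nat.sInf_mem (relRank_set_nonempty G {1})
  exact (Group.rank_le (S := S) (by simpa using hgen)).trans hS.le

theorem substEquiv_of_lt_relRank [Finite G] {r : ℕ} {x y : G} (hx : r - 1 < relRank G {x})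
    (hy : r - 1 < relRank G {y}) : SubstEquiv G r x y := fun z =>
  ⟨fun h => (hx.not_ge (relRank_singleton_le_iff.2 ⟨z, h⟩)).elim,
    fun h => (hy.not_ge (relRank_singleton_le_iff.2 ⟨z, h⟩)).elim⟩

theorem psi_mem [Finite G] :
    0 < psi G ∧ ∀ x y : G, SubstEquiv G (psi G) x y ↔ MaxEquiv G x y :=
  Nat.sInf_mem (psi_set_nonempty G)

theorem rank_le_psi [Finite G] [Nontrivial G] : Group.rank G ≤ psi G := by
  by_contra! h
  obtain ⟨M, hM, -⟩ := (eq_top_or_exists_le_coatom (⊥ : Subgroup G)).resolve_left bot_ne_top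
  refine hM.1 (eq_top_iff.2 fun x _ => ?_)
  have hpos := (psi_mem (G := G)).1
  have hlt : ∀ a : G, psi G - 1 < relRank G {a} := fun a => by
    have := rank_le_relRank_singleton_add_one a
    omega
  exact ((psi_mem.2 x 1).1 (substEquiv_of_lt_relRank (hlt x) (hlt 1)) M hM).2 M.one_mem

theorem efficientlyGenerated_of_psi_eq_rank [Finite G] (h : psi G = Group.rank G) :
    EfficientlyGenerated G := by
  intro x hx
  obtain ⟨hpos, hpsi⟩ := psi_mem (G := G)
  rw [mem_frattini_iff_maxEquiv_one, ← hpsi]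
  have := rank_le_relRank_one (G := G)
  exact substEquiv_of_lt_relRank (by omega) (by omega)

/-- In a soluble group every maximal subgroup `M` is supplemented by a normal subgroup `D` such
that `D ⊓ M` is normal. -/
theorem exists_normal_supplement [Group.IsSolvable G] {M : Subgroup G} (hM : IsCoatom M) :
    ∃ D : Subgroup G, D.Normal ∧ (D ⊓ M).Normal ∧ ¬ D ≤ M ∧ D ⊔ M = ⊤ := by
  classical
  have hex : ∃ n, derivedSeries G n ≤ M := by
    obtain ⟨n, hn⟩ := Group.IsSolvable.solvable (G := G)
    exact ⟨n, hn ▸ bot_le⟩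
  -- `D` is the last term of the derived series not inside `M`, so `⁅D, D⁆ ≤ M`.
  obtain ⟨n, hn⟩ : ∃ n, Nat.find hex = n + 1 := by
    refine Nat.exists_eq_succ_of_ne_zero fun h0 => hM.1 (top_le_iff.1 ?_)
    simpa [h0] using Nat.find_spec hex
  have hD' : ⁅derivedSeries G n, derivedSeries G n⁆ ≤ M := by
    simpa [hn] using Nat.find_spec hex
  have hD : ¬ derivedSeries G n ≤ M := Nat.find_min hex (by omega)
  have hnormal : (derivedSeries G n).Normal := derivedSeries_normal G n
  have hsup : derivedSeries G n ⊔ M = ⊤ := hM.2 _ (right_lt_sup.2 hD)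
  refine ⟨_, hnormal, ⟨fun k hk g => ?_⟩, hD, hsup⟩
  obtain ⟨a, ha, m, hm, rfl⟩ := Subgroup.mem_sup_of_normal_left.1 (hsup ▸ Subgroup.mem_top g)
  refine Subgroup.mem_inf.2 ⟨hnormal.conj_mem _ hk.1 _, ?_⟩
  have hmD : m * k * m⁻¹ ∈ derivedSeries G n := hnormal.conj_mem _ hk.1 _
  have hmM : m * k * m⁻¹ ∈ M := M.mul_mem (M.mul_mem hm hk.2) (M.inv_mem hm)
  have hcomm := hD' (Subgroup.commutator_mem_commutator ha hmD)
  -- Conjugation by `a ∈ D` changes an element of `D` only by a factor in `⁅D, D⁆`.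
  have : a * m * k * (a * m)⁻¹ = ⁅a, m * k * m⁻¹⁆ * (m * k * m⁻¹) := by
    rw [commutatorElement_def]
    group
  rw [this]
  exact M.mul_mem hcomm hmM

/-- In an efficiently generated soluble group, an element outside a maximal subgroup `M` generates
the group together with `d(G) - 1` elements of `M`. -/
theorem exists_generating_tuple_in_maximal [Finite G] [Group.IsSolvable G]
    (hG : EfficientlyGenerated G) {M : Subgroup G} (hM : IsCoatom M) {x : G} (hx : x ∉ M) :
    ∃ z : Fin (Group.rank G - 1) → G, (∀ i, z i ∈ M) ∧
      closure (insert x (Set.range z)) = ⊤ := by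
  have generate : ∀ a : G, a ∉ M →
      ∃ z : Fin (Group.rank G - 1) → G, closure (insert a (Set.range z)) = ⊤ := by
    intro a ha
    refine relRank_singleton_le_iff.1 (Nat.le_sub_one_of_lt ?_)
    exact (relRank_singleton_le_rank a).lt_of_ne fun h => ha (frattini_le_coatom hM (hG a h))
  obtain ⟨D, hDn, hKn, hDM, hsup⟩ := exists_normal_supplement hM
  obtain ⟨a, haD, haM⟩ := SetLike.not_le_iff_exists.1 hDM
  obtain ⟨g, hg⟩ := generate a haM
  have split : ∀ i, ∃ d ∈ D, ∃ m ∈ M, d * m = g i := fun i =>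
    Subgroup.mem_sup_of_normal_left.1 (hsup ▸ Subgroup.mem_top (g i))
  choose d hd m hm hdm using split
  have hmD : closure (Set.range m) ⊔ D = ⊤ := by
    rw [eq_top_iff, ← hg, Subgroup.closure_le, Set.insert_subset_iff, Set.range_subset_iff]
    refine ⟨Subgroup.mem_sup_right haD, fun i => ?_⟩
    rw [← hdm i]
    exact Subgroup.mul_mem _ (Subgroup.mem_sup_right (hd i))
      (Subgroup.mem_sup_left (Subgroup.subset_closure ⟨i, rfl⟩))
  have hmM : closure (Set.range m) ≤ M := by
    rwa [Subgroup.closure_le, Set.range_subset_iff]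
  have hle : closure (Set.range m) ≤ closure (insert x (Set.range m)) :=
    Subgroup.closure_mono (Set.subset_insert _ _)
  -- By the modular law `⟨m⟩(D ⊓ M) = M`, and `x` lies outside the maximal subgroup `M`.
  have hxm : closure (insert x (Set.range m)) ⊔ (D ⊓ M) = ⊤ := by
    refine hM.2 _ (lt_of_le_of_ne (fun b hb => ?_) fun h => hx ?_)
    · obtain ⟨c, hc, e, he, rfl⟩ :=
        Subgroup.mem_sup_of_normal_right.1 (hmD ▸ Subgroup.mem_top b)
      exact Subgroup.mul_mem _ (Subgroup.mem_sup_left (hle hc))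
        (Subgroup.mem_sup_right ⟨he, (M.mul_mem_cancel_left (hmM hc)).1 hb⟩)
    · rw [h]
      exact Subgroup.mem_sup_left (Subgroup.subset_closure (Set.mem_insert _ _))
  obtain ⟨f, hf⟩ := generate x hx
  obtain ⟨k, hk⟩ := exists_translate_generates hf hxm
  exact ⟨_, fun i => M.mul_mem (hm i) (k i).2.2, hk⟩

/-- If `y ∈ M` and `x ∉ M`, a tuple in `M` that generates `G` with `x` cannot do so with `y`. -/
theorem EfficientlyGenerated.maxEquiv_of_substEquiv [Finite G] [Group.IsSolvable G]
    (hG : EfficientlyGenerated G) {x y : G} (h : SubstEquiv G (Group.rank G) x y) :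
    MaxEquiv G x y := by
  have mem_of_mem : ∀ {x y : G}, SubstEquiv G (Group.rank G) x y →
      ∀ M : Subgroup G, IsCoatom M → y ∈ M → x ∈ M := by
    intro x y h M hM hy
    by_contra hx
    obtain ⟨z, hz, hgen⟩ := exists_generating_tuple_in_maximal hG hM hx
    apply hM.1
    rw [eq_top_iff, ← (h z).1 hgen, Subgroup.closure_le]
    exact Set.insert_subset hy (Set.range_subset_iff.2 hz)
  exact fun M hM => ⟨mem_of_mem h.symm M hM, mem_of_mem h M hM⟩

end GenEquiv

theorem mainTheorem5 (G : Type*) [Group G] [Finite G] [Nontrivial G] [Group.IsSolvable G] :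
    GenEquiv.psi G = Group.rank G ↔ GenEquiv.EfficientlyGenerated G := by
  refine ⟨GenEquiv.efficientlyGenerated_of_psi_eq_rank, fun hG => ?_⟩
  exact le_antisymm (Nat.sInf_le ⟨Group.rank_pos G, fun x y =>
    ⟨hG.maxEquiv_of_substEquiv, fun h => h.substEquiv _⟩⟩) GenEquiv.rank_le_psi
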